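/- Let $\tau_2,\mu,C_v,R>0$ be constants and let $\tau_1,\kappa:(0,\infty)\to(0,\infty)$ be $C^2$ functions. Put $Z(\theta)=\tau_1(\theta)/\kappa(\theta)$, $a(\theta)=\frac{Z(\theta)}{\theta}-\frac12 Z'(\theta)$, $e=C_v\theta+a(\theta)q^2$, $p=R\rho\theta$ and $E=\frac12\rho u^2+\frac{\tau_2}{2\mu}\rho S^2+\rho e$. Consider the system $$\rho_t+(\rho u)_x=0,\qquad \rho u_t+\rho uu_x+p_x=S_x,\qquad E_t+(uE+pu+q-Su)_x=0,$$ $$\tau_1(\theta)(\rho q_t+\rho u q_x)+q+\kappa(\theta)\theta_x=0,\qquad \tau_2(\rho S_t+\rho uS_x)+S=\mu u_x$$ on $\mathbb R$, with initial data $(\rho_0,u_0,\theta_0,q_0,S_0)$ at $t=0$. Let $s\ge2$ be an integer, let $(\rho_0-1,u_0,\theta_0-1,q_0,S_0)\in H^s(\mathbb R)$ with $\min_x(\rho_0(x),\theta_0(x))>0$, and let $0<T_0\le\infty$. Let $(\rho,u,\theta,q,S)$ be a solution of this initial value problem on $[0,T_0)$ with $$(\rho-1,u,\theta-1,q,S)\in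 C^0([0,T_0),H^s(\mathbb R))\cap C^1([0,T_0),H^{s-1}(\mathbb R))$$ and $\min_x(\rho(t,x),\theta(t,x))>0$ for all $t\in[0,T_0)$ (functions in $H^s$ and $H^{s-1}$ being identified with their continuous representatives). Let $M>0$ and suppose that $\rho_0-1$, $u_0$, $\theta_0-1$, $q_0$, $S_0$ are compactly supported in $(-M,M)$. Then there is a constant $\sigma>0$ such that for all $0\le t<T_0$ $$(\rho,u,\theta,q,S)(t,x)=(1,0,1,0,0)\qquad\text{whenever } |x|\ge M+\sigma t.$$ -/

import Mathlib

open MeasureTheory Set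
open scoped ContDiff

namespace RelaxedNS

/-- Real-valued test functions `C_c^∞(ℝ)`. -/
def IsTestFunction (φ : ℝ → ℝ) : Prop :=
  ContDiff ℝ ∞ φ ∧ HasCompactSupport φ

theorem IsTestFunction.memLp {φ : ℝ → ℝ} (h : IsTestFunction φ) :
    MemLp φ 2 (volume : Measure ℝ) :=
  h.1.continuous.memLp_of_hasCompactSupport h.2

theorem IsTestFunction.deriv {φ : ℝ → ℝ} (h : IsTestFunction φ) :
    IsTestFunction (deriv φ) :=
  ⟨(contDiff_infty_iff_deriv.1 h.1).2, h.2.deriv⟩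

theorem integrable_mul_test (f : Lp ℝ 2 (volume : Measure ℝ)) {φ : ℝ → ℝ}
    (h : IsTestFunction φ) : Integrable (fun x => f x * φ x) :=
  (Lp.memLp f).integrable_mul h.memLp

/-- `g` is the weak derivative of `f`, for `f, g ∈ L²(ℝ)`. -/
def IsWeakDeriv (f g : Lp ℝ 2 (volume : Measure ℝ)) : Prop :=
  ∀ φ : ℝ → ℝ, IsTestFunction φ → ∫ x, f x * deriv φ x = -∫ x, g x * φ x

theorem isWeakDeriv_zero : IsWeakDeriv 0 0 := by
  intro φ _
  have h0 := Lp.coeFn_zero ℝ 2 (volume : Measure ℝ)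
  have key : ∀ ψ : ℝ → ℝ,
      ∫ x, ((0 : Lp ℝ 2 (volume : Measure ℝ)) : ℝ → ℝ) x * ψ x = 0 := by
    intro ψ
    rw [integral_congr_ae (g := fun _ => (0 : ℝ)), integral_zero]
    filter_upwards [h0] with x hx
    rw [hx, Pi.zero_apply, zero_mul]
  rw [key, key, neg_zero]

theorem integral_add_mul (f g : Lp ℝ 2 (volume : Measure ℝ)) {φ : ℝ → ℝ}
    (h : IsTestFunction φ) :
    ∫ x, (f + g : Lp ℝ 2 (volume : Measure ℝ)) x * φ x
      = (∫ x, f x * φ x) + ∫ x, g x * φ x := by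
  rw [← integral_add (integrable_mul_test f h) (integrable_mul_test g h)]
  refine integral_congr_ae ?_
  filter_upwards [Lp.coeFn_add f g] with x hx
  rw [hx, Pi.add_apply]; ring

theorem integral_smul_mul (c : ℝ) (f : Lp ℝ 2 (volume : Measure ℝ)) (φ : ℝ → ℝ) :
    ∫ x, (c • f : Lp ℝ 2 (volume : Measure ℝ)) x * φ x = c * ∫ x, f x * φ x := by
  rw [← integral_const_mul]
  refine integral_congr_ae ?_
  filter_upwards [Lp.coeFn_smul c f] with x hx
  rw [hx, Pi.smul_apply, smul_eq_mul]; ring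

theorem IsWeakDeriv.add {f g f' g' : Lp ℝ 2 (volume : Measure ℝ)}
    (h : IsWeakDeriv f g) (h' : IsWeakDeriv f' g') : IsWeakDeriv (f + f') (g + g') := by
  intro φ hφ
  rw [integral_add_mul _ _ hφ, integral_add_mul _ _ hφ.deriv, h φ hφ, h' φ hφ]; ring

theorem IsWeakDeriv.smul (c : ℝ) {f g : Lp ℝ 2 (volume : Measure ℝ)}
    (h : IsWeakDeriv f g) : IsWeakDeriv (c • f) (c • g) := by
  intro φ hφ
  rw [integral_smul_mul, integral_smul_mul, h φ hφ]; ring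

/-- The Sobolev space `H^m(ℝ) = W^{m,2}(ℝ)`.  An element is stored together with its weak
derivatives, as the tuple `(f, f', …, f^(m))` of elements of `L²(ℝ)`; the norm inherited from the
`ℓ²`-product is `‖f‖_{H^m} = (∑_{k ≤ m} ‖f^(k)‖_{L²}²)^{1/2}`. -/
def Sobolev (m : ℕ) :
    Submodule ℝ (PiLp 2 (fun _ : Fin (m + 1) => Lp ℝ 2 (volume : Measure ℝ))) where
  carrier := {D | ∀ k : Fin m, IsWeakDeriv (D k.castSucc) (D k.succ)}
  zero_mem' := fun _ => isWeakDeriv_zero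
  add_mem' := fun hf hg k => (hf k).add (hg k)
  smul_mem' := fun c _ hf k => (hf k).smul c

/-- `F ∈ H^m(ℝ)` is the class of the function `f`. -/
def Represents {m : ℕ} (F : Sobolev m) (f : ℝ → ℝ) : Prop :=
  (F.1 0 : ℝ → ℝ) =ᵐ[volume] f

/-- `f ∈ H^m(ℝ)`, where `f` is the continuous representative of its class
(it exists and is unique for `m ≥ 1`). -/
def MemH (m : ℕ) (f : ℝ → ℝ) : Prop :=
  Continuous f ∧ ∃ F : Sobolev m, Represents F f

/-- `f ∈ C^k(I, H^m(ℝ))` for a time interval `I`, where `f t` is the continuous representative of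
its class for all `t ∈ I`. -/
def MemCH (k m : ℕ) (I : Set ℝ) (f : ℝ → ℝ → ℝ) : Prop :=
  (∀ t ∈ I, Continuous (f t)) ∧
    ∃ F : ℝ → Sobolev m, ContDiffOn ℝ k F I ∧ ∀ t ∈ I, Represents (F t) (f t)

/-- The physical coefficients: relaxation function `τ₁`, heat conduction `κ` (both functions of the
temperature, relevant for positive arguments only), relaxation constant `τ₂`, viscosity `μ`, heat
capacity `C_v` and gas constant `R`. -/
structure Coeffs where
  τ₁ : ℝ → ℝ
  κ : ℝ → ℝ
  τ₂ : ℝ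
  μ : ℝ
  Cv : ℝ
  R : ℝ
  τ₁_pos : ∀ θ, 0 < θ → 0 < τ₁ θ
  κ_pos : ∀ θ, 0 < θ → 0 < κ θ
  τ₁_contDiff : ContDiffOn ℝ 2 τ₁ (Ioi 0)
  κ_contDiff : ContDiffOn ℝ 2 κ (Ioi 0)
  τ₂_pos : 0 < τ₂
  μ_pos : 0 < μ
  Cv_pos : 0 < Cv
  R_pos : 0 < R

namespace Coeffs

variable (c : Coeffs)

/-- `Z(θ) = τ₁(θ) / κ(θ)`. -/
noncomputable def Z (θ : ℝ) : ℝ := c.τ₁ θ / c.κ θ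

/-- `a(θ) = Z(θ)/θ - Z'(θ)/2`. -/
noncomputable def a (θ : ℝ) : ℝ := c.Z θ / θ - deriv c.Z θ / 2

/-- Specific internal energy `e = C_v θ + a(θ) q²`. -/
noncomputable def e (θ q : ℝ) : ℝ := c.Cv * θ + c.a θ * q ^ 2

/-- Pressure `p = R ρ θ`. -/
def p (ρ θ : ℝ) : ℝ := c.R * ρ * θ

/-- Total energy `E = ρ u²/2 + τ₂ ρ S²/(2μ) + ρ e`. -/
noncomputable def E (ρ u θ q S : ℝ) : ℝ :=
  ρ * u ^ 2 / 2 + c.τ₂ / (2 * c.μ) * ρ * S ^ 2 + ρ * c.e θ q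

end Coeffs

/-- The time interval `[0, T₀)`, where `T₀ = ∞` is allowed. -/
def timeInterval (T₀ : EReal) : Set ℝ := {t | 0 ≤ t ∧ (t : EReal) < T₀}

/-- The relaxed compressible Navier-Stokes system at the point `(t, x)`; unknowns are written as
functions of time and space, in this order. -/
structure SolvesAt (c : Coeffs) (ρ u θ q S : ℝ → ℝ → ℝ) (t x : ℝ) : Prop where
  mass : deriv (fun r => ρ r x) t + deriv (fun y => ρ t y * u t y) x = 0
  momentum : ρ t x * deriv (fun r => u r x) t + ρ t x * u t x * deriv (fun y => u t y) x
      + deriv (fun y => c.p (ρ t y) (θ t y)) x = deriv (fun y => S t y) x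
  energy : deriv (fun r => c.E (ρ r x) (u r x) (θ r x) (q r x) (S r x)) t
      + deriv (fun y => u t y * c.E (ρ t y) (u t y) (θ t y) (q t y) (S t y)
          + c.p (ρ t y) (θ t y) * u t y + q t y - S t y * u t y) x = 0
  heatFlux : c.τ₁ (θ t x) * (ρ t x * deriv (fun r => q r x) t
        + ρ t x * u t x * deriv (fun y => q t y) x)
      + q t x + c.κ (θ t x) * deriv (fun y => θ t y) x = 0
  stress : c.τ₂ * (ρ t x * deriv (fun r => S r x) t + ρ t x * u t x * deriv (fun y => S t y) x)
      + S t x = c.μ * deriv (fun y => u t y) x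

/-- Admissible initial data: `(ρ₀ - 1, u₀, θ₀ - 1, q₀, S₀) ∈ H^s(ℝ)` and `min (ρ₀, θ₀) > 0`. -/
structure IsData (s : ℕ) (ρ₀ u₀ θ₀ q₀ S₀ : ℝ → ℝ) : Prop where
  mem_ρ : MemH s (fun x => ρ₀ x - 1)
  mem_u : MemH s u₀
  mem_θ : MemH s (fun x => θ₀ x - 1)
  mem_q : MemH s q₀
  mem_S : MemH s S₀
  pos : ∃ δ : ℝ, 0 < δ ∧ ∀ x, δ ≤ ρ₀ x ∧ δ ≤ θ₀ x

/-- `f ∈ C⁰([0,T₀), H^s(ℝ)) ∩ C¹([0,T₀), H^{s-1}(ℝ))`. -/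
def Regular (s : ℕ) (T₀ : EReal) (f : ℝ → ℝ → ℝ) : Prop :=
  MemCH 0 s (timeInterval T₀) f ∧ MemCH 1 (s - 1) (timeInterval T₀) f

/-- `(ρ, u, θ, q, S)` is a local solution on `[0, T₀)` with initial data `(ρ₀, u₀, θ₀, q₀, S₀)`.
For `s ≥ 2` the regularity makes all unknowns `C¹` on `[0,T₀) × ℝ`, so the equations hold in the
classical sense. -/
structure IsSolution (c : Coeffs) (s : ℕ) (T₀ : EReal) (ρ₀ u₀ θ₀ q₀ S₀ : ℝ → ℝ)
    (ρ u θ q S : ℝ → ℝ → ℝ) : Prop where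
  reg_ρ : Regular s T₀ (fun t x => ρ t x - 1)
  reg_u : Regular s T₀ u
  reg_θ : Regular s T₀ (fun t x => θ t x - 1)
  reg_q : Regular s T₀ q
  reg_S : Regular s T₀ S
  pos : ∀ t ∈ timeInterval T₀, ∃ δ : ℝ, 0 < δ ∧ ∀ x, δ ≤ ρ t x ∧ δ ≤ θ t x
  eqs : ∀ t ∈ timeInterval T₀, 0 < t → ∀ x, SolvesAt c ρ u θ q S t x
  init : ρ 0 = ρ₀ ∧ u 0 = u₀ ∧ θ 0 = θ₀ ∧ q 0 = q₀ ∧ S 0 = S₀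

/-- `f` is compactly supported in the open interval `(-M, M)`. -/
def CompactlySupportedIn (M : ℝ) (f : ℝ → ℝ) : Prop :=
  HasCompactSupport f ∧ tsupport f ⊆ Ioo (-M) M

end RelaxedNS

/-! The proof is an energy estimate for the system linearized at the rest state. With `r = ρ - 1`
and `h = θ - 1`, the linearization is symmetrized by the quadratic energy `linEnergy` with flux
`linFlux`. Replacing every coefficient by its value at rest costs a factor that is itself a
deviation. Hence for an actual solution `e_t + f_x` is a quadratic form in `(r, u, h, q, S)` whose
coefficients involve the solution and its first derivatives (`linear_energy_balance`). These are
continuous, so `e_t + f_x ≤ C e` on each compact rectangle, and no smallness or hyperbolicity of the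
nonlinear system is needed.

Since `|f| ≤ σ e` with `σ` depending only on the coefficients (`exists_abs_linFlux_le`), a cut-off
whose edges move inward at speed `σ` turns this into a Gronwall inequality, and `e` vanishes outside
the cone (`eq_zero_of_initially_zero`). The constant `C` may depend on the solution and the
rectangle; it does not enter the speed.

Classical derivatives come from Sobolev regularity by writing point values as inner products in `L²`
(`pointValue`, `Regular.exists_isC1`). -/

namespace RelaxedNS
open Filter Topology

/-! ### Primitives and weak derivatives in `L²`. -/

theorem locallyIntegrable_Lp (g : Lp ℝ 2 (volume : Measure ℝ)) :
    LocallyIntegrable (fun x => g x) :=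
  (Lp.memLp g).locallyIntegrable (by norm_num)

theorem locallyIntegrable_intervalIntegrable {g : ℝ → ℝ} (hg : LocallyIntegrable g) (a b : ℝ) :
    IntervalIntegrable g volume a b :=
  intervalIntegrable_iff.mpr <|
    (hg.integrableOn_isCompact isCompact_uIcc).mono_set uIoc_subset_uIcc

theorem intervalIntegrable_Lp (g : Lp ℝ 2 (volume : Measure ℝ)) (a b : ℝ) :
    IntervalIntegrable (fun x => g x) volume a b :=
  locallyIntegrable_intervalIntegrable (locallyIntegrable_Lp g) a b

/-- Integration by parts for the primitive of a locally integrable function. -/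
theorem integral_primitive_mul_deriv {g : ℝ → ℝ} {a b : ℝ} (hab : a ≤ b)
    (hg : LocallyIntegrable g) (h0 : (0 : ℝ) ∈ Icc a b) {ψ : ℝ → ℝ} (hψ : ContDiff ℝ 1 ψ) :
    ∫ x in a..b, (∫ y in (0 : ℝ)..x, g y) * deriv ψ x
      = (∫ y in (0 : ℝ)..b, g y) * ψ b - (∫ y in (0 : ℝ)..a, g y) * ψ a
        - ∫ x in a..b, g x * ψ x := by
  have hG : AbsolutelyContinuousOnInterval (fun x => ∫ y in (0 : ℝ)..x, g y) a b :=
    (locallyIntegrable_intervalIntegrable hg a b).absolutelyContinuousOnInterval_intervalIntegral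
      (by rwa [uIcc_of_le hab])
  have hψ' : AbsolutelyContinuousOnInterval ψ a b := by
    obtain ⟨K, hK⟩ := hψ.contDiffOn.exists_lipschitzOnWith one_ne_zero (convex_uIcc a b)
      isCompact_uIcc
    exact hK.absolutelyContinuousOnInterval
  rw [hG.integral_mul_deriv_eq_deriv_mul hψ']
  congr 1
  apply intervalIntegral.integral_congr_ae
  filter_upwards [LocallyIntegrable.ae_hasDerivAt_integral hg] with x hx _
  rw [(hx 0).deriv]

theorem integral_eq_intervalIntegral_of_support {f : ℝ → ℝ} {N : ℝ}
    (h : ∀ x, N < |x| → f x = 0) : ∫ x, f x = ∫ x in (-N)..N, f x := by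
  symm
  by_cases hN : 0 ≤ N
  · rw [intervalIntegral.integral_of_le (by linarith), ← integral_Icc_eq_integral_Ioc]
    apply setIntegral_eq_integral_of_forall_compl_eq_zero
    intro x hx
    apply h
    by_contra hx'
    exact hx (abs_le.1 (not_lt.1 hx'))
  · have : f = 0 := by
      ext x
      exact h x (lt_of_lt_of_le (not_le.1 hN) (abs_nonneg x))
    simp [this]

theorem exists_bound_support {f : ℝ → ℝ} (h : HasCompactSupport f) :
    ∃ N : ℝ, 0 ≤ N ∧ ∀ x, N < |x| → f x = 0 := by
  obtain ⟨N, hN⟩ := h.isCompact.isBounded.exists_norm_le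
  refine ⟨max N 0, le_max_right _ _, fun x hx => ?_⟩
  by_contra hne
  have := hN x (subset_tsupport f hne)
  rw [Real.norm_eq_abs] at this
  exact absurd (this.trans (le_max_left N 0)) (not_le.2 hx)

/-- A test function of mean zero is the derivative of a test function. -/
theorem IsTestFunction.exists_primitive {φ : ℝ → ℝ} (h : IsTestFunction φ)
    (h0 : ∫ x, φ x = 0) : ∃ ψ, IsTestFunction ψ ∧ _root_.deriv ψ = φ := by
  obtain ⟨N, hN0, hN⟩ := exists_bound_support h.2
  have hint : ∀ a b, IntervalIntegrable φ volume a b :=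
    fun a b => h.1.continuous.intervalIntegrable a b
  have hd : ∀ x, HasDerivAt (fun x => ∫ y in (-N)..x, φ y) (φ x) x := fun x =>
    h.1.continuous.integral_hasStrictDerivAt (-N) x |>.hasDerivAt
  have hd' : _root_.deriv (fun x => ∫ y in (-N)..x, φ y) = φ := funext fun x => (hd x).deriv
  refine ⟨fun x => ∫ y in (-N)..x, φ y, ⟨?_, ?_⟩, hd'⟩
  · rw [contDiff_infty_iff_deriv, hd']
    exact ⟨fun x => (hd x).differentiableAt, h.1⟩
  · apply HasCompactSupport.intro (isCompact_Icc (a := -N) (b := N))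
    intro x hx
    have hx' : N < |x| := by
      by_contra hc
      exact hx (abs_le.1 (not_lt.1 hc))
    rcases lt_abs.1 hx' with hx1 | hx1
    · rw [← intervalIntegral.integral_add_adjacent_intervals (hint (-N) N) (hint N x),
        ← integral_eq_intervalIntegral_of_support hN, h0, zero_add]
      apply intervalIntegral.integral_zero_ae
      filter_upwards with y hy
      rw [uIoc_of_le hx1.le] at hy
      exact hN y (lt_of_lt_of_le hy.1 (le_abs_self y))
    · rw [intervalIntegral.integral_symm, neg_eq_zero]
      apply intervalIntegral.integral_zero_ae
      -- `hN` needs `N < |y|` strictly, and the half-open interval contains the endpoint `-N`.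
      have hne : ∀ᵐ y : ℝ, y ≠ -N := by simp [ae_iff, measure_singleton]
      filter_upwards [hne] with y hyN hy
      rw [uIoc_of_le (by linarith)] at hy
      exact hN y (lt_abs.2 (Or.inr (by linarith [lt_of_le_of_ne hy.2 hyN])))

theorem integral_primitive_mul_deriv_test (g : Lp ℝ 2 (volume : Measure ℝ)) {ψ : ℝ → ℝ}
    (h : IsTestFunction ψ) :
    ∫ x, (∫ y in (0 : ℝ)..x, g y) * deriv ψ x = -∫ x, g x * ψ x := by
  obtain ⟨N, hN0, hN⟩ := exists_bound_support h.2
  obtain ⟨N', hN0', hN'⟩ := exists_bound_support h.deriv.2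
  set K := max N N' + 1 with hK
  have hK1 : N < K := by linarith [le_max_left N N']
  have hK2 : N' < K := by linarith [le_max_right N N']
  rw [integral_eq_intervalIntegral_of_support (N := K),
    integral_eq_intervalIntegral_of_support (N := K),
    integral_primitive_mul_deriv (by linarith) (locallyIntegrable_Lp g)
      ⟨by linarith, by linarith⟩ (h.1.of_le (by norm_cast)),
    hN K (lt_of_lt_of_le hK1 (le_abs_self K)),
    hN (-K) (by rw [abs_neg]; exact lt_of_lt_of_le hK1 (le_abs_self K))]
  · ring
  · intro x hx; rw [hN x (hK1.trans hx), mul_zero]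
  · intro x hx; rw [hN' x (hK2.trans hx), mul_zero]

/-- The lemma of du Bois-Reymond: an `L²` function with weak derivative `g ∈ L²` is a primitive
of `g`. -/
theorem IsWeakDeriv.exists_ae_eq {f g : Lp ℝ 2 (volume : Measure ℝ)} (h : IsWeakDeriv f g) :
    ∃ C : ℝ, (f : ℝ → ℝ) =ᵐ[volume] fun x => C + ∫ y in (0 : ℝ)..x, g y := by
  set G : ℝ → ℝ := fun x => ∫ y in (0 : ℝ)..x, g y with hGdef
  have hG : Continuous G :=
    intervalIntegral.continuous_primitive (fun a b => intervalIntegrable_Lp g a b) 0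
  let b : ContDiffBump (0 : ℝ) := default
  have hβ : IsTestFunction (b.normed volume) := ⟨b.contDiff_normed, b.hasCompactSupport_normed⟩
  have hβ1 : ∫ x, b.normed volume x = 1 := b.integral_normed
  set β := b.normed volume
  have hint : ∀ φ, IsTestFunction φ → Integrable (fun x => (f x - G x) * φ x) := by
    intro φ hφ
    simp only [sub_mul]
    exact (integrable_mul_test f hφ).sub
      ((hG.mul hφ.1.continuous).integrable_of_hasCompactSupport hφ.2.mul_left)
  have hint' : ∀ φ, IsTestFunction φ → Integrable φ := fun φ hφ =>
    hφ.1.continuous.integrable_of_hasCompactSupport hφ.2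
  set C := ∫ x, (f x - G x) * β x with hC
  refine ⟨C, ?_⟩
  have key : ∀ᵐ x, f x - G x = C := by
    apply ae_eq_of_integral_contDiff_smul_eq
      ((locallyIntegrable_Lp f).sub hG.locallyIntegrable) (locallyIntegrable_const C)
    intro φ h1 h2
    have hφ : IsTestFunction φ := ⟨h1, h2⟩
    set m := ∫ x, φ x with hm
    -- Subtracting `m * β`, with `β` of integral one, leaves a test function of mean zero, hence a
    -- derivative `ψ'`; both `f` and `G` have weak derivative `g`, so `f - G` annihilates it.
    have hχ : IsTestFunction (fun x => φ x - m * β x) :=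
      ⟨h1.sub (contDiff_const.mul hβ.1), h2.sub hβ.2.mul_left⟩
    obtain ⟨ψ, hψ, hψd⟩ := hχ.exists_primitive (by
      rw [integral_sub (hint' φ hφ) ((hint' β hβ).const_mul m), integral_const_mul, hβ1]
      ring)
    have e1 := h ψ hψ
    have e2 := integral_primitive_mul_deriv_test g hψ
    have e3 : ∫ x, (f x - G x) * deriv ψ x = 0 := by
      have hGi : Integrable fun x => G x * deriv ψ x :=
        (hG.mul hψ.deriv.1.continuous).integrable_of_hasCompactSupport hψ.deriv.2.mul_left
      simp only [sub_mul]
      rw [integral_sub (integrable_mul_test f hψ.deriv) hGi, e1, e2, sub_self]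
    rw [hψd] at e3
    have e4 : ∫ x, ((f x - G x) * φ x - m * ((f x - G x) * β x)) = 0 := by
      rw [← e3]; congr 1; ext x; ring
    rw [integral_sub (hint φ hφ) ((hint β hβ).const_mul m), integral_const_mul] at e4
    simp only [smul_eq_mul, integral_mul_const]
    rw [← hm]
    calc ∫ x, φ x * (f x - G x) = ∫ x, (f x - G x) * φ x := by congr 1; ext x; ring
      _ = m * C := by linarith
  filter_upwards [key] with x hx
  linarith

/-! ### Point evaluation through inner products in `L²`. -/

/-- The element of `L²` whose inner product with `g` is `∫_0^x g`. -/
noncomputable def intervalVec (x : ℝ) : Lp ℝ 2 (volume : Measure ℝ) :=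
  indicatorConstLp 2 (measurableSet_Ioc (a := (0 : ℝ)) (b := x)) (by simp) 1 -
    indicatorConstLp 2 (measurableSet_Ioc (a := x) (b := (0 : ℝ))) (by simp) 1

theorem inner_intervalVec (x : ℝ) (g : Lp ℝ 2 (volume : Measure ℝ)) :
    inner ℝ (intervalVec x) g = ∫ y in (0 : ℝ)..x, g y := by
  rw [intervalVec, inner_sub_left, L2.inner_indicatorConstLp_one, L2.inner_indicatorConstLp_one,
    intervalIntegral]

theorem volume_symmDiff_Ioc_le (a b c d : ℝ) :
    volume (symmDiff (Ioc a b) (Ioc c d)) ≤ ENNReal.ofReal (|a - c| + |b - d|) := by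
  have hsub : symmDiff (Ioc a b) (Ioc c d) ⊆ uIcc a c ∪ uIcc b d := by
    intro y hy
    simp only [mem_symmDiff, mem_Ioc, mem_union, mem_uIcc] at hy ⊢
    grind
  refine (measure_mono hsub).trans ((measure_union_le _ _).trans ?_)
  rw [Real.volume_interval, Real.volume_interval, ← ENNReal.ofReal_add (abs_nonneg _) (abs_nonneg _),
    abs_sub_comm c a, abs_sub_comm d b]

theorem continuous_intervalVec : Continuous intervalVec := by
  refine Continuous.sub ?_ ?_ <;>
  · refine continuous_indicatorConstLp_set (by norm_num) fun x => ?_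
    refine tendsto_of_tendsto_of_tendsto_of_le_of_le tendsto_const_nhds ?_
      (fun _ => zero_le) (fun y => volume_symmDiff_Ioc_le _ _ _ _)
    rw [← ENNReal.ofReal_zero]
    refine ENNReal.tendsto_ofReal (Continuous.tendsto' (by fun_prop) _ _ (by simp))

/-- Averaging `f x = f 0 + ∫_0^x g` over `[0, 1]` gives `f 0 = ∫_0^1 f + ∫_0^1 (y - 1) g`; this
weight recovers the constant of integration from `L²` data. -/
theorem memLp_weight :
    MemLp ((Ioc (0 : ℝ) 1).indicator fun y => y - 1) 2 (volume : Measure ℝ) := by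
  rw [memLp_indicator_iff_restrict measurableSet_Ioc]
  exact MemLp.of_bound (by fun_prop) 1 (by
    filter_upwards [ae_restrict_mem measurableSet_Ioc] with y hy
    rw [Real.norm_eq_abs, abs_le]
    constructor <;> linarith [hy.1, hy.2])

/-- Point evaluation of the continuous representative of `f`, with `g` the weak derivative of `f`. -/
noncomputable def pointValue (f g : Lp ℝ 2 (volume : Measure ℝ)) (x : ℝ) : ℝ :=
  inner ℝ (intervalVec 1) f + inner ℝ memLp_weight.toLp g + inner ℝ (intervalVec x) g

/-- Joint continuity converts continuity in time with values in `L²` into continuity in `(t, x)`. -/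
theorem continuous_pointValue : Continuous fun p :
    (Lp ℝ 2 (volume : Measure ℝ) × Lp ℝ 2 (volume : Measure ℝ)) × ℝ =>
      pointValue p.1.1 p.1.2 p.2 := by
  unfold pointValue
  have := continuous_intervalVec
  fun_prop

theorem inner_weight (g : Lp ℝ 2 (volume : Measure ℝ)) :
    inner ℝ memLp_weight.toLp g = ∫ y in (0 : ℝ)..1, g y * (y - 1) := by
  rw [L2.inner_def, intervalIntegral.integral_of_le zero_le_one,
    ← integral_indicator measurableSet_Ioc]
  apply integral_congr_ae
  filter_upwards [memLp_weight.coeFn_toLp] with y hy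
  rw [hy]
  by_cases hy' : y ∈ Ioc (0 : ℝ) 1
  · simp [hy']
  · simp [hy']

theorem IsWeakDeriv.ae_eq_pointValue {f g : Lp ℝ 2 (volume : Measure ℝ)} (h : IsWeakDeriv f g) :
    (f : ℝ → ℝ) =ᵐ[volume] pointValue f g := by
  obtain ⟨C, hC⟩ := h.exists_ae_eq
  have e1 : inner ℝ (intervalVec 1) f = C + ∫ x in (0 : ℝ)..1, ∫ y in (0 : ℝ)..x, g y := by
    rw [inner_intervalVec, intervalIntegral.integral_congr_ae (hC.mono fun x hx _ => hx),
      intervalIntegral.integral_add (by simp)]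
    · simp
    · exact (intervalIntegral.continuous_primitive
        (fun a b => intervalIntegrable_Lp g a b) 0).intervalIntegrable _ _
  -- The choice `ψ = y - 1` has derivative `1` and vanishes at `1`; at `0` the primitive vanishes,
  -- so no boundary term survives.
  have e2 := integral_primitive_mul_deriv (a := 0) (b := 1) zero_le_one (locallyIntegrable_Lp g)
    (by simp) (ψ := fun y => y - 1) (by fun_prop)
  simp only [deriv_sub_const, deriv_id'', mul_one, sub_self, mul_zero,
    intervalIntegral.integral_same, zero_mul, zero_sub] at e2
  filter_upwards [hC] with x hx
  have ep : pointValue f g x = inner ℝ (intervalVec 1) f + inner ℝ memLp_weight.toLp g +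
    inner ℝ (intervalVec x) g := rfl
  rw [hx, ep, e1, e2, inner_weight, inner_intervalVec]
  ring

/-- A second weak derivative gives `g` a continuous representative, so the fundamental theorem of
calculus applies at every point. -/
theorem IsWeakDeriv.hasDerivAt_pointValue {f g k : Lp ℝ 2 (volume : Measure ℝ)}
    (h : IsWeakDeriv g k) (x : ℝ) :
    HasDerivAt (pointValue f g) (pointValue g k x) x := by
  have hc : Continuous (pointValue g k) :=
    continuous_pointValue.comp (g := fun p : (Lp ℝ 2 (volume : Measure ℝ) ×
      Lp ℝ 2 (volume : Measure ℝ)) × ℝ => pointValue p.1.1 p.1.2 p.2)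
      (f := fun x => ((g, k), x)) (by fun_prop)
  have := (hc.integral_hasStrictDerivAt 0 x).hasDerivAt.const_add
    (inner ℝ (intervalVec 1) f + inner ℝ memLp_weight.toLp g)
  refine this.congr_of_eventuallyEq (Eventually.of_forall fun y => ?_)
  change inner ℝ (intervalVec 1) f + inner ℝ memLp_weight.toLp g + inner ℝ (intervalVec y) g = _
  rw [inner_intervalVec y,
    intervalIntegral.integral_congr_ae (h.ae_eq_pointValue.mono fun x hx _ => hx)]

theorem HasDerivAt.pointValue {F G : ℝ → Lp ℝ 2 (volume : Measure ℝ)}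
    {F' G' : Lp ℝ 2 (volume : Measure ℝ)} {t : ℝ}
    (hF : HasDerivAt F F' t) (hG : HasDerivAt G G' t) (x : ℝ) :
    HasDerivAt (fun r => pointValue (F r) (G r) x) (pointValue F' G' x) t := by
  have hi : ∀ (v : Lp ℝ 2 (volume : Measure ℝ)) {H : ℝ → Lp ℝ 2 (volume : Measure ℝ)}
      {H' : Lp ℝ 2 (volume : Measure ℝ)}, HasDerivAt H H' t →
      HasDerivAt (fun r => inner ℝ v (H r)) (inner ℝ v H') t := fun v H H' hH =>
    (innerSL ℝ v).hasFDerivAt.comp_hasDerivAt t hH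
  exact ((hi _ hF).add (hi _ hG)).add (hi _ hG)

/-! ### From Sobolev regularity to `C¹` on `[0, T] × ℝ`. -/

/-- The `k`-th weak derivative. -/
noncomputable def Sobolev.weakDeriv {m : ℕ} (k : Fin (m + 1)) :
    Sobolev m →L[ℝ] Lp ℝ 2 (volume : Measure ℝ) :=
  (PiLp.proj 2 (fun _ : Fin (m + 1) => Lp ℝ 2 (volume : Measure ℝ)) k).comp (Sobolev m).subtypeL

theorem Sobolev.isWeakDeriv_zero_one {m : ℕ} (F : Sobolev (m + 1)) :
    IsWeakDeriv (Sobolev.weakDeriv 0 F) (Sobolev.weakDeriv 1 F) :=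
  F.2 0

theorem Sobolev.isWeakDeriv_one_two {m : ℕ} (F : Sobolev (m + 2)) :
    IsWeakDeriv (Sobolev.weakDeriv 1 F) (Sobolev.weakDeriv 2 F) := by
  have := F.2 1
  exact this

theorem Represents.eq_pointValue {m : ℕ} {F : Sobolev (m + 1)} {f : ℝ → ℝ}
    (h : Represents F f) (hf : Continuous f) :
    f = RelaxedNS.pointValue (Sobolev.weakDeriv 0 F) (Sobolev.weakDeriv 1 F) := by
  refine Continuous.ae_eq_iff_eq volume hf ?_ |>.1 ?_
  · exact continuous_pointValue.comp (g := fun p : (Lp ℝ 2 (volume : Measure ℝ) ×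
      Lp ℝ 2 (volume : Measure ℝ)) × ℝ => RelaxedNS.pointValue p.1.1 p.1.2 p.2)
      (f := fun x => ((_, _), x)) (by fun_prop)
  · exact (EventuallyEq.symm h).trans (Sobolev.isWeakDeriv_zero_one F).ae_eq_pointValue

theorem continuousOn_pointValue {I : Set ℝ} {F G : ℝ → Lp ℝ 2 (volume : Measure ℝ)}
    (hF : ContinuousOn F I) (hG : ContinuousOn G I) :
    ContinuousOn (fun p : ℝ × ℝ => pointValue (F p.1) (G p.1) p.2) (I ×ˢ univ) := by
  refine continuous_pointValue.comp_continuousOn (g := fun p : (Lp ℝ 2 (volume : Measure ℝ) ×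
      Lp ℝ 2 (volume : Measure ℝ)) × ℝ => RelaxedNS.pointValue p.1.1 p.1.2 p.2)
      (f := fun p : ℝ × ℝ => ((F p.1, G p.1), p.2)) ?_
  have h1 : MapsTo (Prod.fst : ℝ × ℝ → ℝ) (I ×ˢ univ) I := fun p hp => hp.1
  exact ((hF.comp continuousOn_fst h1).prodMk (hG.comp continuousOn_fst h1)).prodMk
    continuousOn_snd

/-- `f` is of class `C¹` on `[0, T] × ℝ`, with partial derivatives `ft` and `fx`; the time
derivative is only claimed for interior times. -/
structure IsC1 (T : ℝ) (f ft fx : ℝ → ℝ → ℝ) : Prop where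
  cont : ContinuousOn (fun p : ℝ × ℝ => f p.1 p.2) (Icc 0 T ×ˢ univ)
  cont_t : ContinuousOn (fun p : ℝ × ℝ => ft p.1 p.2) (Icc 0 T ×ˢ univ)
  cont_x : ContinuousOn (fun p : ℝ × ℝ => fx p.1 p.2) (Icc 0 T ×ˢ univ)
  deriv_t : ∀ t ∈ Ioo 0 T, ∀ x, HasDerivAt (fun r => f r x) (ft t x) t
  deriv_x : ∀ t ∈ Icc 0 T, ∀ x, HasDerivAt (fun y => f t y) (fx t x) x

theorem Icc_subset_timeInterval {T₀ : EReal} {T : ℝ} (hT : (T : EReal) < T₀) :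
    Icc 0 T ⊆ timeInterval T₀ := fun _ ht =>
  ⟨ht.1, lt_of_le_of_lt (EReal.coe_le_coe_iff.2 ht.2) hT⟩

/-- The space derivative uses two weak derivatives of the `H^s`-valued curve, whence `s ≥ 2`; the
time derivative uses the `C¹` curve in `H^(s-1)`, where one weak derivative is enough for point
values. -/
theorem Regular.exists_isC1 {s : ℕ} (hs : 2 ≤ s) {T₀ : EReal} {f : ℝ → ℝ → ℝ}
    (h : Regular s T₀ f) {T : ℝ} (hT0 : 0 < T)
    (hT : (T : EReal) < T₀) : ∃ ft fx : ℝ → ℝ → ℝ, IsC1 T f ft fx := by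
  obtain ⟨n, rfl⟩ := Nat.exists_eq_add_of_le' hs
  obtain ⟨⟨hc, F, hF, hrep⟩, h'⟩ := h
  change MemCH 1 (n + 1) _ _ at h'
  obtain ⟨-, G, hG, hrepG⟩ := h'
  have hI := Icc_subset_timeInterval hT
  have hF' : ContinuousOn F (Icc 0 T) := (hF.continuousOn).mono hI
  have hG1 : ContDiffOn ℝ 1 G (Icc 0 T) := (by exact_mod_cast hG : ContDiffOn ℝ 1 G _).mono hI
  -- `derivWithin` is one-sided at the endpoints, so the time derivative is continuous up to `t = 0`
  -- and `t = T`.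
  have hG' : ContinuousOn (derivWithin G (Icc 0 T)) (Icc 0 T) :=
    hG1.continuousOn_derivWithin (uniqueDiffOn_Icc hT0) le_rfl
  have hcomp : ∀ {m : ℕ} (k : Fin (m + 1)) {H : ℝ → Sobolev m}, ContinuousOn H (Icc 0 T) →
      ContinuousOn (fun t => Sobolev.weakDeriv k (H t)) (Icc 0 T) := fun k H hH =>
    (Sobolev.weakDeriv k).continuous.comp_continuousOn hH
  refine ⟨fun t x => pointValue (Sobolev.weakDeriv 0 (derivWithin G (Icc 0 T) t))
      (Sobolev.weakDeriv 1 (derivWithin G (Icc 0 T) t)) x,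
    fun t x => pointValue (Sobolev.weakDeriv 1 (F t)) (Sobolev.weakDeriv 2 (F t)) x,
    ?_, ?_, ?_, ?_, ?_⟩
  · refine (continuousOn_pointValue (hcomp 0 hF') (hcomp 1 hF')).congr ?_
    rintro ⟨t, x⟩ ⟨ht, -⟩
    exact congrFun ((hrep t (hI ht)).eq_pointValue (hc t (hI ht))) x
  · have h0 := hcomp (H := derivWithin G (Icc 0 T)) 0 hG'
    have h1 := hcomp (H := derivWithin G (Icc 0 T)) 1 hG'
    have h2 := continuousOn_pointValue h0 h1
    exact h2
  · have h1 := hcomp (H := F) 1 hF'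
    have h2 := hcomp (H := F) 2 hF'
    have h3 := continuousOn_pointValue h1 h2
    exact h3
  · intro t ht x
    have hnhds : Icc 0 T ∈ 𝓝 t := Icc_mem_nhds ht.1 ht.2
    have hd : HasDerivAt G (derivWithin G (Icc 0 T) t) t :=
      ((hG1.differentiableOn one_ne_zero) t (Ioo_subset_Icc_self ht)).hasDerivWithinAt.hasDerivAt
        hnhds
    have hD : ∀ k : Fin (n + 1 + 1), HasDerivAt (fun r => Sobolev.weakDeriv k (G r))
        (Sobolev.weakDeriv k (derivWithin G (Icc 0 T) t)) t := fun k =>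
      by
      have e := (Sobolev.weakDeriv (m := n + 1) k).hasFDerivAt (x := G t)
      exact e.comp_hasDerivAt t hd
    have := HasDerivAt.pointValue (hD 0) (hD 1) x
    refine this.congr_of_eventuallyEq ?_
    filter_upwards [hnhds] with r hr
    exact congrFun ((hrepG r (hI hr)).eq_pointValue (hc r (hI hr))) x
  · intro t ht x
    have e := (hrep t (hI ht)).eq_pointValue (hc t (hI ht))
    have := (Sobolev.isWeakDeriv_one_two (F t)).hasDerivAt_pointValue
      (f := Sobolev.weakDeriv 0 (F t)) x
    rw [← e] at this
    exact this

namespace IsC1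

variable {T : ℝ} {f ft fx g gt gx : ℝ → ℝ → ℝ}

theorem add (hf : IsC1 T f ft fx) (hg : IsC1 T g gt gx) :
    IsC1 T (fun t x => f t x + g t x) (fun t x => ft t x + gt t x)
      (fun t x => fx t x + gx t x) where
  cont := hf.cont.add hg.cont
  cont_t := hf.cont_t.add hg.cont_t
  cont_x := hf.cont_x.add hg.cont_x
  deriv_t t ht x := (hf.deriv_t t ht x).add (hg.deriv_t t ht x)
  deriv_x t ht x := (hf.deriv_x t ht x).add (hg.deriv_x t ht x)

theorem mul (hf : IsC1 T f ft fx) (hg : IsC1 T g gt gx) :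
    IsC1 T (fun t x => f t x * g t x) (fun t x => ft t x * g t x + f t x * gt t x)
      (fun t x => fx t x * g t x + f t x * gx t x) where
  cont := hf.cont.mul hg.cont
  cont_t := (hf.cont_t.mul hg.cont).add (hf.cont.mul hg.cont_t)
  cont_x := (hf.cont_x.mul hg.cont).add (hf.cont.mul hg.cont_x)
  deriv_t t ht x := (hf.deriv_t t ht x).mul (hg.deriv_t t ht x)
  deriv_x t ht x := (hf.deriv_x t ht x).mul (hg.deriv_x t ht x)

theorem const_mul (c : ℝ) (hf : IsC1 T f ft fx) :
    IsC1 T (fun t x => c * f t x) (fun t x => c * ft t x) (fun t x => c * fx t x) where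
  cont := continuousOn_const.mul hf.cont
  cont_t := continuousOn_const.mul hf.cont_t
  cont_x := continuousOn_const.mul hf.cont_x
  deriv_t t ht x := (hf.deriv_t t ht x).const_mul c
  deriv_x t ht x := (hf.deriv_x t ht x).const_mul c

theorem reflect (hf : IsC1 T f ft fx) :
    IsC1 T (fun t x => f t (-x)) (fun t x => ft t (-x)) (fun t x => -fx t (-x)) := by
  have h : ContinuousOn (fun p : ℝ × ℝ => (p.1, -p.2)) (Icc 0 T ×ˢ univ) := by fun_prop
  have hm : MapsTo (fun p : ℝ × ℝ => (p.1, -p.2)) (Icc 0 T ×ˢ univ) (Icc 0 T ×ˢ univ) :=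
    fun p hp => ⟨hp.1, mem_univ _⟩
  refine ⟨hf.cont.comp h hm, hf.cont_t.comp h hm, (hf.cont_x.comp h hm).neg,
    fun t ht x => hf.deriv_t t ht (-x), fun t ht x => ?_⟩
  have := (hf.deriv_x t ht (-x)).comp x (hasDerivAt_neg x)
  rw [mul_neg_one] at this
  exact this

end IsC1

section slices

variable {T : ℝ} {f : ℝ → ℝ → ℝ}

theorem continuous_slice
    (hf : ContinuousOn (fun p : ℝ × ℝ => f p.1 p.2) (Icc 0 T ×ˢ univ)) {t : ℝ}
    (ht : t ∈ Icc 0 T) : Continuous (f t) := by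
  rw [← continuousOn_univ]
  exact hf.comp (f := fun x => (t, x)) (by fun_prop) fun x _ => ⟨ht, mem_univ x⟩

theorem continuousOn_time_slice
    (hf : ContinuousOn (fun p : ℝ × ℝ => f p.1 p.2) (Icc 0 T ×ˢ univ)) (x : ℝ) :
    ContinuousOn (fun t => f t x) (Icc 0 T) :=
  hf.comp (f := fun t => (t, x)) (by fun_prop) fun _ ht => ⟨ht, mem_univ x⟩

theorem exists_bound_on_rectangle
    (hf : ContinuousOn (fun p : ℝ × ℝ => f p.1 p.2) (Icc 0 T ×ˢ univ)) (a b : ℝ) :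
    ∃ K : ℝ, 0 ≤ K ∧ ∀ t ∈ Icc 0 T, ∀ x ∈ Icc a b, |f t x| ≤ K := by
  obtain ⟨K, hK⟩ := (isCompact_Icc.prod isCompact_Icc).exists_bound_of_continuousOn
    (hf.mono (prod_mono_right (subset_univ (Icc a b))))
  exact ⟨max K 0, le_max_right _ _, fun t ht x hx => (hK (t, x) ⟨ht, hx⟩).trans (le_max_left _ _)⟩

end slices

/-! ### Gronwall's inequality and finite speed of propagation for a scalar density. -/

variable {T : ℝ}

/-- A nonnegative density `P` with flux `Q` vanishing at the ends of `[a, b]` that satisfies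
`P_t + Q_x ≤ C P` vanishes if it does so initially. -/
theorem density_eq_zero (hT : 0 ≤ T) {P Pt Px Q Qt Qx : ℝ → ℝ → ℝ} (hP : IsC1 T P Pt Px)
    (hQ : IsC1 T Q Qt Qx) {a b C : ℝ} (hab : a < b)
    (hpos : ∀ t ∈ Icc 0 T, ∀ x ∈ Icc a b, 0 ≤ P t x)
    (hQa : ∀ t ∈ Icc 0 T, Q t a = 0) (hQb : ∀ t ∈ Icc 0 T, Q t b = 0)
    (hle : ∀ t ∈ Ioo 0 T, ∀ x ∈ Icc a b, Pt t x + Qx t x ≤ C * P t x)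
    (h0 : ∀ x ∈ Icc a b, P 0 x = 0) : ∀ x ∈ Icc a b, P T x = 0 := by
  have hint : ∀ {f : ℝ → ℝ → ℝ},
      ContinuousOn (fun p : ℝ × ℝ => f p.1 p.2) (Icc 0 T ×ˢ univ) → ∀ t ∈ Icc 0 T,
      IntervalIntegrable (f t) volume a b := fun hf t ht =>
    (continuous_slice hf ht).intervalIntegrable a b
  have hmeas : ∀ {f : ℝ → ℝ → ℝ},
      ContinuousOn (fun p : ℝ × ℝ => f p.1 p.2) (Icc 0 T ×ˢ univ) → ∀ t ∈ Icc 0 T,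
      AEStronglyMeasurable (f t) (volume.restrict (uIoc a b)) := fun hf t ht =>
    (continuous_slice hf ht).aestronglyMeasurable
  obtain ⟨K, hK0, hK⟩ := exists_bound_on_rectangle hP.cont a b
  obtain ⟨K', hK'0, hK'⟩ := exists_bound_on_rectangle hP.cont_t a b
  have hmem : ∀ x ∈ uIoc a b, x ∈ Icc a b := fun x hx => by
    rw [uIoc_of_le hab.le] at hx; exact Ioc_subset_Icc_self hx
  set I : ℝ → ℝ := fun t => ∫ x in a..b, P t x with hI
  have hIc : ContinuousOn I (Icc 0 T) := by
    intro t ht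
    apply intervalIntegral.continuousWithinAt_of_dominated_interval (bound := fun _ => K)
    · filter_upwards [self_mem_nhdsWithin] with r hr using hmeas hP.cont r hr
    · filter_upwards [self_mem_nhdsWithin] with r hr
      exact Eventually.of_forall fun x hx => hK r hr x (hmem x hx)
    · simp
    · exact Eventually.of_forall fun x hx => continuousOn_time_slice hP.cont x t ht
  have hId : ∀ t ∈ Ioo 0 T, HasDerivAt I (∫ x in a..b, Pt t x) t := by
    intro t ht
    have hsub := Ioo_subset_Icc_self (a := 0) (b := T)
    refine (intervalIntegral.hasDerivAt_integral_of_dominated_loc_of_deriv_le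
      (s := Ioo 0 T) (bound := fun _ => K') (Ioo_mem_nhds ht.1 ht.2) ?_
      (hint hP.cont t (hsub ht)) (hmeas hP.cont_t t (hsub ht)) ?_ (by simp) ?_).2
    · filter_upwards [Ioo_mem_nhds ht.1 ht.2] with r hr using hmeas hP.cont r (hsub hr)
    · exact Eventually.of_forall fun x hx r hr => hK' r (hsub hr) x (hmem x hx)
    · exact Eventually.of_forall fun x hx r hr => hP.deriv_t r hr x
  have hIle : ∀ t ∈ Ioo 0 T, ∫ x in a..b, Pt t x ≤ C * I t := by
    intro t ht
    have ht' := Ioo_subset_Icc_self ht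
    have e1 : ∫ x in a..b, Qx t x = 0 := by
      rw [intervalIntegral.integral_eq_sub_of_hasDerivAt (fun x _ => hQ.deriv_x t ht' x)
        (hint hQ.cont_x t ht'), hQa t ht', hQb t ht', sub_self]
    have e2 : ∫ x in a..b, (Pt t x + Qx t x) ≤ ∫ x in a..b, C * P t x :=
      intervalIntegral.integral_mono_on hab.le
        ((hint hP.cont_t t ht').add (hint hQ.cont_x t ht')) ((hint hP.cont t ht').const_mul C)
        (hle t ht)
    rwa [intervalIntegral.integral_add (hint hP.cont_t t ht') (hint hQ.cont_x t ht'), e1, add_zero,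
      intervalIntegral.integral_const_mul] at e2
  -- Gronwall by integrating factor: `exp (-C t) I(t)` is nonincreasing and starts at `0`.
  have hJd : ∀ t ∈ Ioo 0 T, HasDerivAt (fun t => Real.exp (-C * t) * I t)
      (Real.exp (-C * t) * ((∫ x in a..b, Pt t x) - C * I t)) t := by
    intro t ht
    have h1 : HasDerivAt (fun t => Real.exp (-C * t)) (Real.exp (-C * t) * (-C)) t := by
      simpa using ((hasDerivAt_id t).const_mul (-C)).exp
    refine (h1.mul (hId t ht)).congr_deriv ?_
    ring
  have hJ : AntitoneOn (fun t => Real.exp (-C * t) * I t) (Icc 0 T) := by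
    apply antitoneOn_of_deriv_nonpos (convex_Icc 0 T)
    · exact (by fun_prop : Continuous fun t => Real.exp (-C * t)).continuousOn.mul hIc
    · rw [interior_Icc]
      exact fun t ht => (hJd t ht).differentiableAt.differentiableWithinAt
    · rw [interior_Icc]
      intro t ht
      rw [(hJd t ht).deriv]
      exact mul_nonpos_of_nonneg_of_nonpos (Real.exp_pos _).le (sub_nonpos.2 (hIle t ht))
  have hI0 : I 0 = 0 := by
    rw [hI]
    simp only
    rw [intervalIntegral.integral_congr (g := fun _ => (0 : ℝ))]
    · simp
    · intro x hx
      rw [uIcc_of_le hab.le] at hx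
      exact h0 x hx
  have hIT : I T ≤ 0 := by
    have := hJ (left_mem_Icc.2 hT) (right_mem_Icc.2 hT) hT
    simp only [hI0, mul_zero] at this
    exact nonpos_of_mul_nonpos_right this (Real.exp_pos _)
  intro x hx
  by_contra hne
  have hTm := right_mem_Icc.2 hT
  have := intervalIntegral.integral_pos hab (continuous_slice hP.cont hTm).continuousOn
    (fun y hy => hpos T hTm y (Ioc_subset_Icc_self hy))
    ⟨x, hx, lt_of_le_of_ne (hpos T hTm x hx) (Ne.symm hne)⟩
  exact absurd hIT (not_le.2 this)

/-- A continuously differentiable cut-off function, vanishing exactly on `(-∞, 0]`. -/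
noncomputable def posSq (y : ℝ) : ℝ := max y 0 ^ 2

theorem hasDerivAt_posSq (y : ℝ) : HasDerivAt posSq (2 * max y 0) y := by
  rcases lt_trichotomy y 0 with hy | rfl | hy
  · rw [max_eq_right hy.le, mul_zero]
    refine (hasDerivAt_const y (0 : ℝ)).congr_of_eventuallyEq ?_
    filter_upwards [Iio_mem_nhds hy] with z hz
    rw [posSq, max_eq_right (le_of_lt hz)]; norm_num
  · rw [max_self, mul_zero]
    rw [hasDerivAt_iff_isLittleO_nhds_zero]
    simp only [posSq, zero_add, max_self, smul_zero, sub_zero, ne_eq, OfNat.ofNat_ne_zero,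
      not_false_eq_true, zero_pow]
    refine Asymptotics.IsBigO.trans_isLittleO (g := fun h : ℝ => h ^ 2) ?_
      (by simpa using Asymptotics.isLittleO_pow_id (𝕜 := ℝ) one_lt_two)
    refine Asymptotics.IsBigO.of_bound 1 (Eventually.of_forall fun h => ?_)
    rw [one_mul, Real.norm_eq_abs, Real.norm_eq_abs, abs_of_nonneg (by positivity),
      abs_of_nonneg (by positivity), sq_le_sq, abs_of_nonneg (le_max_right h 0)]
    exact max_le (le_abs_self h) (abs_nonneg h)
  · rw [max_eq_left hy.le]
    have : HasDerivAt (fun z : ℝ => z ^ 2) (2 * y) y := by simpa using hasDerivAt_pow 2 y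
    refine this.congr_of_eventuallyEq ?_
    filter_upwards [Ioi_mem_nhds hy] with z hz
    rw [posSq, max_eq_left (le_of_lt hz)]

theorem isC1_posSq_affine (T α β γ : ℝ) :
    IsC1 T (fun t x => posSq (α + β * t + γ * x))
      (fun t x => 2 * max (α + β * t + γ * x) 0 * β)
      (fun t x => 2 * max (α + β * t + γ * x) 0 * γ) where
  cont := Continuous.continuousOn (by unfold posSq; fun_prop)
  cont_t := Continuous.continuousOn (by fun_prop)
  cont_x := Continuous.continuousOn (by fun_prop)
  deriv_t t _ x := by
    have h : HasDerivAt (fun r => α + β * r + γ * x) β t := by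
      simpa using (((hasDerivAt_id t).const_mul β).const_add α).add_const (γ * x)
    exact (hasDerivAt_posSq _).comp t h
  deriv_x t _ x := by
    have h : HasDerivAt (fun y => α + β * t + γ * y) γ x := by
      simpa using ((hasDerivAt_id x).const_mul γ).const_add (α + β * t)
    exact (hasDerivAt_posSq _).comp x h

/-- Finite speed of propagation for a nonnegative density `e` whose flux `f` is dominated by
`σ e`. -/
theorem eq_zero_of_initially_zero (hT : 0 ≤ T) {σ M : ℝ} (hσ : 0 ≤ σ)
    {e et ex f ft fx : ℝ → ℝ → ℝ} (he : IsC1 T e et ex) (hf : IsC1 T f ft fx)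
    (hpos : ∀ t ∈ Icc 0 T, ∀ x, 0 ≤ e t x) (hfe : ∀ t ∈ Icc 0 T, ∀ x, |f t x| ≤ σ * e t x)
    (hle : ∀ a b : ℝ, ∃ C : ℝ, ∀ t ∈ Ioo 0 T, ∀ x ∈ Icc a b, et t x + fx t x ≤ C * e t x)
    (h0 : ∀ x, M ≤ x → e 0 x = 0) {x : ℝ} (hx : M + σ * T < x) : e T x = 0 := by
  -- The trapezoid `M + σ t < y < L - σ t` still contains `x` at time `T`, since `L - σ T - x = 1`.
  set L := x + σ * T + 1 with hL
  have hσT : 0 ≤ σ * T := mul_nonneg hσ hT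
  obtain ⟨C, hC⟩ := hle M L
  have h1 := isC1_posSq_affine T (-M) (-σ) 1
  have h2 := isC1_posSq_affine T L (-σ) (-1)
  have hφ := h1.mul h2
  have hzero : ∀ y : ℝ, y ≤ 0 → posSq y = 0 := fun y hy => by
    rw [posSq, max_eq_right hy]; norm_num
  have hnn : ∀ y, 0 ≤ posSq y := fun y => sq_nonneg _
  have hx' : x ∈ Icc M L := ⟨by linarith, by linarith⟩
  have := density_eq_zero hT (hφ.mul he) (hφ.mul hf) (C := C) (a := M) (b := L) (by linarith)
    ?_ ?_ ?_ ?_ ?_ x hx'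
  · rcases mul_eq_zero.1 this with h | h
    · exfalso
      have p1 : 0 < posSq (-M + -σ * T + 1 * x) :=
        pow_pos (lt_max_of_lt_left (by linarith)) 2
      have p2 : 0 < posSq (L + -σ * T + -1 * x) :=
        pow_pos (lt_max_of_lt_left (by linarith)) 2
      exact (mul_pos p1 p2).ne' h
    · exact h
  · intro t ht y _
    exact mul_nonneg (mul_nonneg (hnn _) (hnn _)) (hpos t ht y)
  · intro t ht
    rw [hzero (-M + -σ * t + 1 * M) (by nlinarith [mul_nonneg hσ ht.1])]
    ring
  · intro t ht
    rw [hzero (L + -σ * t + -1 * L) (by nlinarith [mul_nonneg hσ ht.1])]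
    ring
  · intro t ht y hy
    have hC' := mul_le_mul_of_nonneg_left (hC t ht y hy)
      (mul_nonneg (hnn (-M + -σ * t + 1 * y)) (hnn (L + -σ * t + -1 * y)))
    have hfl := abs_le.1 (hfe t (Ioo_subset_Icc_self ht) y)
    set A := -M + -σ * t + 1 * y
    set B := L + -σ * t + -1 * y
    -- With `φ = posSq A * posSq B`, the cut-off contributes `φ_t e + φ_x f`, which is minus twice
    -- the sum of the expressions in `k1` and `k2`; the bound `|f| ≤ σ e` makes both nonnegative.
    have k1 : 0 ≤ max A 0 * posSq B * (σ * e t y - f t y) :=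
      mul_nonneg (mul_nonneg (le_max_right _ _) (hnn _)) (by linarith)
    have k2 : 0 ≤ posSq A * max B 0 * (σ * e t y + f t y) :=
      mul_nonneg (mul_nonneg (hnn _) (le_max_right _ _)) (by linarith)
    nlinarith
  · intro y hy
    rw [h0 y hy.1, mul_zero]

/-! ### The coefficient functions and the quadratic energy at rest. -/

namespace Coeffs

variable (c : Coeffs)

theorem Z_contDiffOn : ContDiffOn ℝ 2 c.Z (Ioi 0) :=
  c.τ₁_contDiff.div c.κ_contDiff fun θ hθ => (c.κ_pos θ hθ).ne'

theorem Z_pos {θ : ℝ} (hθ : 0 < θ) : 0 < c.Z θ := div_pos (c.τ₁_pos θ hθ) (c.κ_pos θ hθ)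

theorem a_contDiffOn : ContDiffOn ℝ 1 c.a (Ioi 0) := by
  have h1 : ContDiffOn ℝ 1 c.Z (Ioi 0) := c.Z_contDiffOn.of_le one_le_two
  have h2 : ContDiffOn ℝ 1 (deriv c.Z) (Ioi 0) :=
    ((contDiffOn_succ_iff_deriv_of_isOpen (n := 1) isOpen_Ioi).1
      (by simpa [one_add_one_eq_two] using c.Z_contDiffOn)).2.2
  exact (h1.div contDiffOn_id fun θ hθ => ne_of_gt hθ).sub (h2.div_const 2)

theorem continuousOn_deriv_a : ContinuousOn (deriv c.a) (Ioi 0) :=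
  c.a_contDiffOn.continuousOn_deriv_of_isOpen isOpen_Ioi le_rfl

theorem hasDerivAt_a {θ : ℝ} (hθ : 0 < θ) : HasDerivAt c.a (deriv c.a θ) θ :=
  ((c.a_contDiffOn.differentiableOn one_ne_zero).differentiableAt
    (isOpen_Ioi.mem_nhds hθ)).hasDerivAt

/-- Lets `Z θ - Z 1` be written as `θ - 1` times a continuous function, also across `θ = 1`. -/
theorem continuousOn_dslope_Z : ContinuousOn (dslope c.Z 1) (Ioi 0) := by
  rw [continuousOn_dslope (isOpen_Ioi.mem_nhds (mem_Ioi.2 one_pos))]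
  exact ⟨c.Z_contDiffOn.continuousOn, (c.Z_contDiffOn.differentiableOn two_ne_zero).differentiableAt
    (isOpen_Ioi.mem_nhds (mem_Ioi.2 one_pos))⟩

theorem hasDerivAt_E {ρ u θ q S : ℝ → ℝ} {ρ' u' θ' q' S' x : ℝ} (hθ : 0 < θ x)
    (h1 : HasDerivAt ρ ρ' x) (h2 : HasDerivAt u u' x) (h3 : HasDerivAt θ θ' x)
    (h4 : HasDerivAt q q' x) (h5 : HasDerivAt S S' x) :
    HasDerivAt (fun y => c.E (ρ y) (u y) (θ y) (q y) (S y))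
      (ρ' * u x ^ 2 / 2 + ρ x * u x * u' + c.τ₂ / (2 * c.μ) * (ρ' * S x ^ 2 + 2 * ρ x * S x * S')
        + ρ' * c.e (θ x) (q x) + ρ x * (c.Cv * θ' + deriv c.a (θ x) * θ' * q x ^ 2
          + 2 * c.a (θ x) * q x * q')) x := by
  have ha : HasDerivAt (fun y => c.a (θ y)) (deriv c.a (θ x) * θ') x :=
    (c.hasDerivAt_a hθ).comp x h3
  have := (((h1.mul (h2.pow 2)).div_const 2).add
    ((h1.const_mul (c.τ₂ / (2 * c.μ))).mul (h5.pow 2))).add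
    (h1.mul ((h3.const_mul c.Cv).add (ha.mul (h4.pow 2))))
  refine this.congr_deriv ?_
  simp only [e, Pi.pow_apply, Pi.mul_apply, Pi.add_apply]
  push_cast
  ring

/-- The energy density of the system linearized at the rest state. -/
noncomputable def linEnergy (r u h q S : ℝ) : ℝ :=
  c.R / 2 * (r * r) + (1 / 2 * (u * u) + (c.Cv / 2 * (h * h) + (c.Z 1 / 2 * (q * q)
    + c.τ₂ / (2 * c.μ) * (S * S))))

/-- The energy flux of the system linearized at the rest state. -/
def linFlux (r u h q S : ℝ) : ℝ :=
  c.R * (r * u) + (c.R * (u * h) + (-1 * (u * S) + h * q))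

theorem exists_sq_le_linEnergy : ∃ C : ℝ, 0 < C ∧ ∀ r u h q S : ℝ,
    r ^ 2 + u ^ 2 + h ^ 2 + q ^ 2 + S ^ 2 ≤ C * c.linEnergy r u h q S := by
  have hR := c.R_pos
  have hC := c.Cv_pos
  have hZ := c.Z_pos one_pos
  have hS : 0 < c.τ₂ / c.μ := div_pos c.τ₂_pos c.μ_pos
  set w := c.τ₂ / c.μ with hw
  have hw2 : c.τ₂ / (2 * c.μ) = w / 2 := by rw [hw]; ring
  -- The sum of the reciprocal weights dominates each of them; the `2` compensates the halves in the
  -- energy.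
  refine ⟨2 * (1 / c.R + 1 + 1 / c.Cv + 1 / c.Z 1 + 1 / w), by positivity, fun r u h q S => ?_⟩
  set D := 1 / c.R + 1 + 1 / c.Cv + 1 / c.Z 1 + 1 / w
  have key : ∀ k : ℝ, 0 < k → 1 / k ≤ D → ∀ y : ℝ, y ^ 2 ≤ D * (k * y ^ 2) := by
    intro k hk hkD y
    have : 1 ≤ D * k := by rwa [div_le_iff₀ hk] at hkD
    nlinarith [sq_nonneg y]
  have p1 : 0 < 1 / c.R := by positivity
  have p2 : 0 < 1 / c.Cv := by positivity
  have p3 : 0 < 1 / c.Z 1 := by positivity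
  have p4 : 0 < 1 / w := by positivity
  have k1 := key c.R hR (by simp only [D]; linarith) r
  have k2 := key 1 one_pos (by simp only [D]; linarith) u
  have k3 := key c.Cv hC (by simp only [D]; linarith) h
  have k4 := key (c.Z 1) hZ (by simp only [D]; linarith) q
  have k5 := key w hS (by simp only [D]; linarith) S
  rw [linEnergy, hw2]
  linarith

theorem linEnergy_nonneg (r u h q S : ℝ) : 0 ≤ c.linEnergy r u h q S := by
  obtain ⟨C, hC, hle⟩ := c.exists_sq_le_linEnergy
  have := hle r u h q S
  have h2 : 0 ≤ C * c.linEnergy r u h q S := le_trans (by positivity) this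
  exact nonneg_of_mul_nonneg_right h2 hC

theorem eq_zero_of_linEnergy_eq_zero {r u h q S : ℝ} (h0 : c.linEnergy r u h q S = 0) :
    r = 0 ∧ u = 0 ∧ h = 0 ∧ q = 0 ∧ S = 0 := by
  obtain ⟨C, hC, hle⟩ := c.exists_sq_le_linEnergy
  have := hle r u h q S
  rw [h0, mul_zero] at this
  refine ⟨?_, ?_, ?_, ?_, ?_⟩ <;> rw [← sq_eq_zero_iff] <;>
    linarith [sq_nonneg r, sq_nonneg u, sq_nonneg h, sq_nonneg q, sq_nonneg S]

/-- Each product in the flux is bounded by squares. This is the source of the propagation speed,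
which depends on the coefficients only. -/
theorem exists_abs_linFlux_le : ∃ σ : ℝ, 0 < σ ∧ ∀ r u h q S : ℝ,
    |c.linFlux r u h q S| ≤ σ * c.linEnergy r u h q S := by
  obtain ⟨C, hC, hle⟩ := c.exists_sq_le_linEnergy
  have hR := c.R_pos
  refine ⟨(c.R + 1) * C, by positivity, fun r u h q S => ?_⟩
  have h1 : |c.linFlux r u h q S| ≤ (c.R + 1) * (r ^ 2 + u ^ 2 + h ^ 2 + q ^ 2 + S ^ 2) := by
    rw [abs_le, linFlux]
    constructor <;>
      nlinarith [mul_nonneg hR.le (sq_nonneg (r + u)), mul_nonneg hR.le (sq_nonneg (r - u)),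
        mul_nonneg hR.le (sq_nonneg (u + h)), mul_nonneg hR.le (sq_nonneg (u - h)),
        mul_nonneg hR.le (sq_nonneg r), mul_nonneg hR.le (sq_nonneg h),
        mul_nonneg hR.le (sq_nonneg q), mul_nonneg hR.le (sq_nonneg S),
        sq_nonneg (u + S), sq_nonneg (u - S), sq_nonneg (h + q), sq_nonneg (h - q), sq_nonneg r]
  refine h1.trans ?_
  rw [mul_assoc]
  exact mul_le_mul_of_nonneg_left (hle r u h q S) (by positivity)

end Coeffs

/-! ### The energy balance as a quadratic form in the deviation. -/

/-- At a point where the relaxed system holds, the linearized energy balance is a quadratic form in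
the deviation from the rest state, with coefficients depending on the solution and its first
derivatives. -/
theorem linear_energy_balance (c : Coeffs)
    {ρ u θ q S rt rx ut ux ht hx qt qx St Sx : ℝ} (hθ : 0 < θ)
    (e1 : rt + (rx * u + ρ * ux) = 0)
    (e2 : ρ * ut + ρ * u * ux + c.R * (rx * θ + ρ * hx) = Sx)
    (e3 : rt * u ^ 2 / 2 + ρ * u * ut + c.τ₂ / (2 * c.μ) * (rt * S ^ 2 + 2 * ρ * S * St)
        + rt * c.e θ q + ρ * (c.Cv * ht + deriv c.a θ * ht * q ^ 2 + 2 * c.a θ * q * qt)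
      + (ux * c.E ρ u θ q S + u * (rx * u ^ 2 / 2 + ρ * u * ux
        + c.τ₂ / (2 * c.μ) * (rx * S ^ 2 + 2 * ρ * S * Sx)
        + rx * c.e θ q + ρ * (c.Cv * hx + deriv c.a θ * hx * q ^ 2 + 2 * c.a θ * q * qx))
        + (c.R * (rx * θ + ρ * hx) * u + c.p ρ θ * ux) + qx - (Sx * u + S * ux)) = 0)
    (e4 : c.τ₁ θ * (ρ * qt + ρ * u * qx) + q + c.κ θ * hx = 0)
    (e5 : c.τ₂ * (ρ * St + ρ * u * Sx) + S = c.μ * ux) :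
    c.R * (ρ - 1) * (rt + ux) + u * (ut + c.R * rx + c.R * hx - Sx)
      + (θ - 1) * (c.Cv * ht + c.R * ux + qx) + q * (c.Z 1 * qt + hx)
      + S * (c.τ₂ / c.μ * St - ux)
    = (ρ - 1) * (-(c.R * rx) * u)
      + (ρ - 1) * (-(c.R * ux) * (ρ - 1))
      + u * (-(ut + c.R * hx) * (ρ - 1))
      + u * (-(ρ * ux) * u)
      + u * (-(c.R * rx) * (θ - 1))
      + (θ - 1) * (-(c.Cv * ht + c.R * θ * ux) * (ρ - 1))
      + (θ - 1) * (-(ρ * c.Cv * hx) * u)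
      + (θ - 1) * (-(c.R * ux) * (θ - 1))
      + (θ - 1) * (-(ρ * deriv c.a θ * q * (ht + u * hx)
        + 2 * c.a θ * ρ * (qt + u * qx)) * q)
      + (θ - 1) * (S / c.μ * S)
      + q * (-(c.Z θ * qt) * (ρ - 1))
      + q * (-(c.Z θ * ρ * qx) * u)
      + q * (-(dslope c.Z 1 θ * qt) * (θ - 1))
      + q * (-(1 / c.κ θ) * q)
      + S * (-(c.τ₂ / c.μ * St) * (ρ - 1))
      + S * (-(c.τ₂ / c.μ * ρ * Sx) * u)
      + S * (-(1 / c.μ) * S) := by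
  have hκ := (c.κ_pos θ hθ).ne'
  have hμ := c.μ_pos.ne'
  have hD : (θ - 1) * dslope c.Z 1 θ = c.Z θ - c.Z 1 := by
    simpa using sub_smul_dslope c.Z 1 θ
  -- Dividing by `κ` symmetrizes: the terms `q * hx` and `(θ - 1) * qx` then combine into the flux
  -- derivative `(h q)_x`. Division of the stress equation by `μ` plays the same role for `u` and
  -- `S`.
  have e4' : c.Z θ * (ρ * qt + ρ * u * qx) + 1 / c.κ θ * q + hx = 0 := by
    rw [Coeffs.Z]; field_simp; linarith
  have e5' : c.τ₂ / c.μ * (ρ * St + ρ * u * Sx) + 1 / c.μ * S = ux := by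
    field_simp; linarith
  -- Removing mass, kinetic energy and stress energy from the total energy balance leaves the
  -- internal energy equation, with the dissipation `S ^ 2 / μ` as source.
  have hT : ρ * (c.Cv * ht + deriv c.a θ * ht * q ^ 2 + 2 * c.a θ * q * qt)
      + ρ * u * (c.Cv * hx + deriv c.a θ * hx * q ^ 2 + 2 * c.a θ * q * qx)
      + c.R * ρ * θ * ux + qx - 1 / c.μ * S ^ 2 = 0 := by
    rw [Coeffs.E, Coeffs.p] at e3
    linear_combination e3 - (u ^ 2 / 2 + c.τ₂ / (2 * c.μ) * S ^ 2 + c.e θ q) * e1 - u * e2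
      - S * e5'
  linear_combination c.R * (ρ - 1) * e1 + u * e2 + (θ - 1) * hT + q * e4' + S * e5'
    + q * qt * hD

theorem mul_mul_le_abs_mul {N x y k : ℝ} (hx : x ^ 2 ≤ N) (hy : y ^ 2 ≤ N) :
    x * (k * y) ≤ |k| * N := by
  have h : |x * y| ≤ N := by
    rw [abs_le]; constructor <;> nlinarith [sq_nonneg (x + y), sq_nonneg (x - y)]
  calc x * (k * y) = k * (x * y) := by ring
    _ ≤ |k * (x * y)| := le_abs_self _
    _ = |k| * |x * y| := abs_mul _ _
    _ ≤ |k| * N := mul_le_mul_of_nonneg_left h (abs_nonneg _)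

/-- `F` is bounded above by a multiple of `N` on every rectangle `(0, T) × [a, b]`. -/
def IsDominated (T : ℝ) (N F : ℝ → ℝ → ℝ) : Prop :=
  ∀ a b : ℝ, ∃ C : ℝ, 0 ≤ C ∧ ∀ t ∈ Ioo 0 T, ∀ x ∈ Icc a b, F t x ≤ C * N t x

theorem IsDominated.add {T : ℝ} {N F G : ℝ → ℝ → ℝ} (hF : IsDominated T N F)
    (hG : IsDominated T N G) : IsDominated T N (fun t x => F t x + G t x) := by
  intro a b
  obtain ⟨C, hC0, hC⟩ := hF a b
  obtain ⟨D, hD0, hD⟩ := hG a b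
  refine ⟨C + D, add_nonneg hC0 hD0, fun t ht x hx => ?_⟩
  rw [add_mul]
  exact add_le_add (hC t ht x hx) (hD t ht x hx)

theorem IsDominated.mul {T : ℝ} {N f g k : ℝ → ℝ → ℝ} (hf : ∀ t x, f t x ^ 2 ≤ N t x)
    (hg : ∀ t x, g t x ^ 2 ≤ N t x)
    (hk : ContinuousOn (fun p : ℝ × ℝ => k p.1 p.2) (Icc 0 T ×ˢ univ)) :
    IsDominated T N (fun t x => f t x * (k t x * g t x)) := by
  intro a b
  obtain ⟨K, hK0, hK⟩ := exists_bound_on_rectangle hk a b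
  refine ⟨K, hK0, fun t ht x hx => (mul_mul_le_abs_mul (hf t x) (hg t x)).trans ?_⟩
  exact mul_le_mul_of_nonneg_right (hK t (Ioo_subset_Icc_self ht) x hx)
    ((sq_nonneg _).trans (hf t x))

/-! ### Finite speed of propagation for classical solutions. -/

/-- The unknowns are `C¹` on `[0, T] × ℝ` with the given partial derivatives, `ρ = 1 + r` and
`θ = 1 + h`, and satisfy the system for interior times. -/
structure ClassicalSolution (c : Coeffs) (T : ℝ)
    (r rt rx u ut ux h ht hx q qt qx S St Sx : ℝ → ℝ → ℝ) : Prop where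
  r_C1 : IsC1 T r rt rx
  u_C1 : IsC1 T u ut ux
  h_C1 : IsC1 T h ht hx
  q_C1 : IsC1 T q qt qx
  S_C1 : IsC1 T S St Sx
  pos : ∀ t ∈ Icc 0 T, ∀ x, 0 < h t x + 1
  eqs : ∀ t ∈ Ioo 0 T, ∀ x,
    SolvesAt c (fun t x => r t x + 1) u (fun t x => h t x + 1) q S t x

namespace ClassicalSolution

variable {c : Coeffs} {T : ℝ} {r rt rx u ut ux h ht hx q qt qx S St Sx : ℝ → ℝ → ℝ}

theorem exists_isC1 (H : ClassicalSolution c T r rt rx u ut ux h ht hx q qt qx S St Sx) :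
    ∃ et ex ft fx : ℝ → ℝ → ℝ,
      IsC1 T (fun t x => c.linEnergy (r t x) (u t x) (h t x) (q t x) (S t x)) et ex ∧
      IsC1 T (fun t x => c.linFlux (r t x) (u t x) (h t x) (q t x) (S t x)) ft fx ∧
      ∀ t x, et t x + fx t x = c.R * r t x * (rt t x + ux t x)
        + u t x * (ut t x + c.R * rx t x + c.R * hx t x - Sx t x)
        + h t x * (c.Cv * ht t x + c.R * ux t x + qx t x) + q t x * (c.Z 1 * qt t x + hx t x)
        + S t x * (c.τ₂ / c.μ * St t x - ux t x) :=
  ⟨_, _, _, _, ((H.r_C1.mul H.r_C1).const_mul (c.R / 2)).add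
    (((H.u_C1.mul H.u_C1).const_mul (1 / 2)).add
      (((H.h_C1.mul H.h_C1).const_mul (c.Cv / 2)).add
        (((H.q_C1.mul H.q_C1).const_mul (c.Z 1 / 2)).add
          ((H.S_C1.mul H.S_C1).const_mul (c.τ₂ / (2 * c.μ)))))),
    ((H.r_C1.mul H.u_C1).const_mul c.R).add
    (((H.u_C1.mul H.h_C1).const_mul c.R).add
      (((H.u_C1.mul H.S_C1).const_mul (-1)).add (H.h_C1.mul H.q_C1))),
    fun t x => by ring⟩

theorem balance (H : ClassicalSolution c T r rt rx u ut ux h ht hx q qt qx S St Sx) {t : ℝ}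
    (htT : t ∈ Ioo 0 T) (x : ℝ) :
    c.R * r t x * (rt t x + ux t x)
      + u t x * (ut t x + c.R * rx t x + c.R * hx t x - Sx t x)
      + h t x * (c.Cv * ht t x + c.R * ux t x + qx t x) + q t x * (c.Z 1 * qt t x + hx t x)
      + S t x * (c.τ₂ / c.μ * St t x - ux t x)
    = r t x * (-(c.R * rx t x) * u t x)
      + r t x * (-(c.R * ux t x) * r t x)
      + u t x * (-(ut t x + c.R * hx t x) * r t x)
      + u t x * (-((r t x + 1) * ux t x) * u t x)
      + u t x * (-(c.R * rx t x) * h t x)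
      + h t x * (-(c.Cv * ht t x + c.R * (h t x + 1) * ux t x) * r t x)
      + h t x * (-((r t x + 1) * c.Cv * hx t x) * u t x)
      + h t x * (-(c.R * ux t x) * h t x)
      + h t x * (-((r t x + 1) * deriv c.a (h t x + 1) * q t x * (ht t x + u t x * hx t x)
        + 2 * c.a (h t x + 1) * (r t x + 1) * (qt t x + u t x * qx t x)) * q t x)
      + h t x * (S t x / c.μ * S t x)
      + q t x * (-(c.Z (h t x + 1) * qt t x) * r t x)
      + q t x * (-(c.Z (h t x + 1) * (r t x + 1) * qx t x) * u t x)
      + q t x * (-(dslope c.Z 1 (h t x + 1) * qt t x) * h t x)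
      + q t x * (-(1 / c.κ (h t x + 1)) * q t x)
      + S t x * (-(c.τ₂ / c.μ * St t x) * r t x)
      + S t x * (-(c.τ₂ / c.μ * (r t x + 1) * Sx t x) * u t x)
      + S t x * (-(1 / c.μ) * S t x) := by
  have hI := Ioo_subset_Icc_self htT
  have hpos := H.pos t hI x
  obtain ⟨e1, e2, e3, e4, e5⟩ := H.eqs t htT x
  have dr := (H.r_C1.deriv_t t htT x).add_const 1
  have dr' := (H.r_C1.deriv_x t hI x).add_const 1
  have du := H.u_C1.deriv_t t htT x
  have du' := H.u_C1.deriv_x t hI x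
  have dh := (H.h_C1.deriv_t t htT x).add_const 1
  have dh' := (H.h_C1.deriv_x t hI x).add_const 1
  have dq := H.q_C1.deriv_t t htT x
  have dq' := H.q_C1.deriv_x t hI x
  have dS := H.S_C1.deriv_t t htT x
  have dS' := H.S_C1.deriv_x t hI x
  have dp : HasDerivAt (fun y => c.p (r t y + 1) (h t y + 1))
      (c.R * (rx t x * (h t x + 1) + (r t x + 1) * hx t x)) x :=
    ((dr'.const_mul c.R).mul dh').congr_deriv (by ring)
  have dE := c.hasDerivAt_E (x := t) hpos dr du dh dq dS
  have dE' := c.hasDerivAt_E (x := x) hpos dr' du' dh' dq' dS'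
  have dru : HasDerivAt (fun y => (r t y + 1) * u t y) _ x := dr'.mul du'
  have dF : HasDerivAt (fun y => u t y * c.E (r t y + 1) (u t y) (h t y + 1) (q t y) (S t y)
      + c.p (r t y + 1) (h t y + 1) * u t y + q t y - S t y * u t y) _ x :=
    (((du'.mul dE').add (dp.mul du')).add dq').sub (dS'.mul du')
  rw [dr.deriv, dru.deriv] at e1
  rw [du.deriv, du'.deriv, dp.deriv, dS'.deriv] at e2
  rw [dE.deriv, dF.deriv] at e3
  rw [dq.deriv, dq'.deriv, dh'.deriv] at e4
  rw [dS.deriv, dS'.deriv, du'.deriv] at e5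
  have := linear_energy_balance c hpos e1 e2 e3 e4 e5
  simpa only [add_sub_cancel_right] using this

/-- Each of the 17 summands in `balance` is deviation times continuous coefficient times deviation,
the shape handled by `IsDominated.mul`. Positivity of `h + 1` keeps the arguments of `Z`, `a` and
`κ` in the region where they are regular. -/
theorem balance_le (H : ClassicalSolution c T r rt rx u ut ux h ht hx q qt qx S St Sx) (a b : ℝ) :
    ∃ C : ℝ, 0 ≤ C ∧ ∀ t ∈ Ioo 0 T, ∀ x ∈ Icc a b,
      c.R * r t x * (rt t x + ux t x)
        + u t x * (ut t x + c.R * rx t x + c.R * hx t x - Sx t x)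
        + h t x * (c.Cv * ht t x + c.R * ux t x + qx t x) + q t x * (c.Z 1 * qt t x + hx t x)
        + S t x * (c.τ₂ / c.μ * St t x - ux t x)
      ≤ C * (r t x ^ 2 + u t x ^ 2 + h t x ^ 2 + q t x ^ 2 + S t x ^ 2) := by
  have hR : ContinuousOn (fun p : ℝ × ℝ => r p.1 p.2 + 1) (Icc 0 T ×ˢ univ) :=
    H.r_C1.cont.add continuousOn_const
  have hθ : ContinuousOn (fun p : ℝ × ℝ => h p.1 p.2 + 1) (Icc 0 T ×ˢ univ) :=
    H.h_C1.cont.add continuousOn_const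
  have hcomp : ∀ {g : ℝ → ℝ}, ContinuousOn g (Ioi 0) →
      ContinuousOn (fun p : ℝ × ℝ => g (h p.1 p.2 + 1)) (Icc 0 T ×ˢ univ) := fun hg =>
    hg.comp hθ fun p hp => H.pos p.1 hp.1 p.2
  have hZ := hcomp c.Z_contDiffOn.continuousOn
  have ha := hcomp c.a_contDiffOn.continuousOn
  have ha' := hcomp c.continuousOn_deriv_a
  have hD := hcomp c.continuousOn_dslope_Z
  have hκ := hcomp (g := fun y => 1 / c.κ y)
    (continuousOn_const.div c.κ_contDiff.continuousOn fun y hy => (c.κ_pos y hy).ne')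
  have hk : ∀ k : ℝ, ContinuousOn (fun _ : ℝ × ℝ => k) (Icc 0 T ×ˢ univ) :=
    fun k => continuousOn_const
  have hu := H.u_C1.cont
  have hq := H.q_C1.cont
  have hS := H.S_C1.cont
  have hrx := H.r_C1.cont_x
  have hut := H.u_C1.cont_t
  have hux := H.u_C1.cont_x
  have hht := H.h_C1.cont_t
  have hhx := H.h_C1.cont_x
  have hqt := H.q_C1.cont_t
  have hqx := H.q_C1.cont_x
  have hSt := H.S_C1.cont_t
  have hSx := H.S_C1.cont_x
  set N : ℝ → ℝ → ℝ := fun t x => r t x ^ 2 + u t x ^ 2 + h t x ^ 2 + q t x ^ 2 + S t x ^ 2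
  have nr : ∀ t x, r t x ^ 2 ≤ N t x := fun t x => by
    simp only [N]
    linarith [sq_nonneg (u t x), sq_nonneg (h t x), sq_nonneg (q t x), sq_nonneg (S t x)]
  have nu : ∀ t x, u t x ^ 2 ≤ N t x := fun t x => by
    simp only [N]
    linarith [sq_nonneg (r t x), sq_nonneg (h t x), sq_nonneg (q t x), sq_nonneg (S t x)]
  have nh : ∀ t x, h t x ^ 2 ≤ N t x := fun t x => by
    simp only [N]
    linarith [sq_nonneg (r t x), sq_nonneg (u t x), sq_nonneg (q t x), sq_nonneg (S t x)]
  have nq : ∀ t x, q t x ^ 2 ≤ N t x := fun t x => by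
    simp only [N]
    linarith [sq_nonneg (r t x), sq_nonneg (u t x), sq_nonneg (h t x), sq_nonneg (S t x)]
  have nS : ∀ t x, S t x ^ 2 ≤ N t x := fun t x => by
    simp only [N]
    linarith [sq_nonneg (r t x), sq_nonneg (u t x), sq_nonneg (h t x), sq_nonneg (q t x)]
  suffices hdom : IsDominated T N (fun t x =>
      r t x * (-(c.R * rx t x) * u t x)
      + r t x * (-(c.R * ux t x) * r t x)
      + u t x * (-(ut t x + c.R * hx t x) * r t x)
      + u t x * (-((r t x + 1) * ux t x) * u t x)
      + u t x * (-(c.R * rx t x) * h t x)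
      + h t x * (-(c.Cv * ht t x + c.R * (h t x + 1) * ux t x) * r t x)
      + h t x * (-((r t x + 1) * c.Cv * hx t x) * u t x)
      + h t x * (-(c.R * ux t x) * h t x)
      + h t x * (-((r t x + 1) * deriv c.a (h t x + 1) * q t x * (ht t x + u t x * hx t x)
        + 2 * c.a (h t x + 1) * (r t x + 1) * (qt t x + u t x * qx t x)) * q t x)
      + h t x * (S t x / c.μ * S t x)
      + q t x * (-(c.Z (h t x + 1) * qt t x) * r t x)
      + q t x * (-(c.Z (h t x + 1) * (r t x + 1) * qx t x) * u t x)
      + q t x * (-(dslope c.Z 1 (h t x + 1) * qt t x) * h t x)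
      + q t x * (-(1 / c.κ (h t x + 1)) * q t x)
      + S t x * (-(c.τ₂ / c.μ * St t x) * r t x)
      + S t x * (-(c.τ₂ / c.μ * (r t x + 1) * Sx t x) * u t x)
      + S t x * (-(1 / c.μ) * S t x)) by
    obtain ⟨C, hC0, hC⟩ := hdom a b
    refine ⟨C, hC0, fun t ht x hx => ?_⟩
    rw [H.balance ht x]
    exact hC t ht x hx
  refine .add (.add (.add (.add (.add (.add (.add (.add (.add (.add (.add (.add (.add (.add (.add
    (.add (.mul nr nu ?_) (.mul nr nr ?_)) (.mul nu nr ?_)) (.mul nu nu ?_)) (.mul nu nh ?_))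
    (.mul nh nr ?_)) (.mul nh nu ?_)) (.mul nh nh ?_)) (.mul nh nq ?_)) (.mul nh nS ?_))
    (.mul nq nr ?_)) (.mul nq nu ?_)) (.mul nq nh ?_)) (.mul nq nq ?_)) (.mul nS nr ?_))
    (.mul nS nu ?_)) (.mul nS nS ?_)
  · exact ((hk c.R).mul hrx).neg
  · exact ((hk c.R).mul hux).neg
  · exact (hut.add ((hk c.R).mul hhx)).neg
  · exact (hR.mul hux).neg
  · exact ((hk c.R).mul hrx).neg
  · exact (((hk c.Cv).mul hht).add (((hk c.R).mul hθ).mul hux)).neg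
  · exact ((hR.mul (hk c.Cv)).mul hhx).neg
  · exact ((hk c.R).mul hux).neg
  · exact ((((hR.mul ha').mul hq).mul (hht.add (hu.mul hhx))).add
      ((((hk 2).mul ha).mul hR).mul (hqt.add (hu.mul hqx)))).neg
  · exact hS.div_const c.μ
  · exact (hZ.mul hqt).neg
  · exact ((hZ.mul hR).mul hqx).neg
  · exact (hD.mul hqt).neg
  · exact hκ.neg
  · exact ((hk (c.τ₂ / c.μ)).mul hSt).neg
  · exact (((hk (c.τ₂ / c.μ)).mul hR).mul hSx).neg
  · exact (hk (1 / c.μ)).neg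

theorem eq_zero_of_initially_zero
    (H : ClassicalSolution c T r rt rx u ut ux h ht hx q qt qx S St Sx) (hT : 0 ≤ T) {σ M : ℝ}
    (hσ : 0 ≤ σ) (hσ' : ∀ r u h q S : ℝ, |c.linFlux r u h q S| ≤ σ * c.linEnergy r u h q S)
    (h0 : ∀ x, M ≤ |x| → r 0 x = 0 ∧ u 0 x = 0 ∧ h 0 x = 0 ∧ q 0 x = 0 ∧ S 0 x = 0)
    {x : ℝ} (hxM : M + σ * T ≤ |x|) :
    r T x = 0 ∧ u T x = 0 ∧ h T x = 0 ∧ q T x = 0 ∧ S T x = 0 := by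
  apply c.eq_zero_of_linEnergy_eq_zero
  obtain ⟨et, ex, ft, fx, he, hf, hef⟩ := H.exists_isC1
  set e : ℝ → ℝ → ℝ := fun t x => c.linEnergy (r t x) (u t x) (h t x) (q t x) (S t x)
  have hle : ∀ a b : ℝ, ∃ C : ℝ, ∀ t ∈ Ioo 0 T, ∀ x ∈ Icc a b,
      et t x + fx t x ≤ C * e t x := by
    intro a b
    obtain ⟨C, hC0, hC⟩ := H.balance_le a b
    obtain ⟨D, -, hD⟩ := c.exists_sq_le_linEnergy
    refine ⟨C * D, fun t ht x hx => ?_⟩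
    rw [hef, mul_assoc C D]
    exact (hC t ht x hx).trans (mul_le_mul_of_nonneg_left (hD _ _ _ _ _) hC0)
  have he0 : ∀ x, M ≤ |x| → e 0 x = 0 := by
    intro x hx
    obtain ⟨a1, a2, a3, a4, a5⟩ := h0 x hx
    simp only [e, a1, a2, a3, a4, a5, Coeffs.linEnergy]
    ring
  have hec : Continuous (e T) := continuous_slice he.cont (right_mem_Icc.2 hT)
  have key : ∀ y, M + σ * T < |y| → e T y = 0 := by
    intro y hy
    rcases lt_abs.1 hy with hy | hy
    · exact RelaxedNS.eq_zero_of_initially_zero hT hσ he hf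
        (fun t _ x => c.linEnergy_nonneg _ _ _ _ _) (fun t _ x => hσ' _ _ _ _ _) hle
        (fun x hx => he0 x (hx.trans (le_abs_self x))) hy
    -- The left half-line follows by `x ↦ -x`; reflection reverses the sign of the space derivative,
    -- so the flux becomes `-f t (-x)`.
    · have := RelaxedNS.eq_zero_of_initially_zero hT hσ he.reflect (hf.reflect.const_mul (-1))
        (fun t _ x => c.linEnergy_nonneg _ _ _ _ _)
        (fun t _ x => by rw [abs_mul, abs_neg, abs_one, one_mul]; exact hσ' _ _ _ _ _)
        (fun a b => by
          obtain ⟨C, hC⟩ := hle (-b) (-a)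
          refine ⟨C, fun t ht x hx => ?_⟩
          have := hC t ht (-x) ⟨neg_le_neg hx.2, neg_le_neg hx.1⟩
          linarith)
        (fun x hx => he0 (-x) (by rw [abs_neg]; exact hx.trans (le_abs_self x))) hy
      rwa [neg_neg] at this
  -- The estimate covers the open exterior of the cone; its boundary is reached by continuity in
  -- `x`, approaching from outside.
  rcases hxM.lt_or_eq with hlt | heq
  · exact key x hlt
  · rcases le_total 0 x with hx0 | hx0
    · have hclo : x ∈ closure (Ioi x) := by rw [closure_Ioi]; exact self_mem_Ici
      refine closure_minimal (s := Ioi x) (t := {y | e T y = 0}) (fun y hy => ?_)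
        (isClosed_eq hec continuous_const) hclo
      apply key
      rw [heq, abs_of_nonneg hx0]
      exact lt_of_lt_of_le hy (le_abs_self y)
    · have hclo : x ∈ closure (Iio x) := by rw [closure_Iio]; exact self_mem_Iic
      refine closure_minimal (s := Iio x) (t := {y | e T y = 0}) (fun y hy => ?_)
        (isClosed_eq hec continuous_const) hclo
      apply key
      rw [heq, abs_of_nonpos hx0]
      exact lt_of_lt_of_le (neg_lt_neg hy) (neg_le_abs y)

end ClassicalSolution

/-! ### Application to the Sobolev solution. -/

theorem CompactlySupportedIn.eq_zero {M : ℝ} {f : ℝ → ℝ} (hf : CompactlySupportedIn M f) {x : ℝ}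
    (hx : M ≤ |x|) : f x = 0 := by
  by_contra hne
  have := hf.2 (subset_tsupport f hne)
  exact absurd (abs_lt.2 this) (not_lt.2 hx)

theorem IsSolution.classicalSolution {c : Coeffs} {s : ℕ} (hs : 2 ≤ s) {T₀ : EReal}
    {ρ₀ u₀ θ₀ q₀ S₀ : ℝ → ℝ} {ρ u θ q S : ℝ → ℝ → ℝ}
    (hsol : IsSolution c s T₀ ρ₀ u₀ θ₀ q₀ S₀ ρ u θ q S) {T : ℝ} (hT0 : 0 < T)
    (hT : (T : EReal) < T₀) :
    ∃ rt rx ut ux ht hx qt qx St Sx : ℝ → ℝ → ℝ,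
      ClassicalSolution c T (fun t x => ρ t x - 1) rt rx u ut ux (fun t x => θ t x - 1) ht hx
        q qt qx S St Sx := by
  obtain ⟨rt, rx, h1⟩ := hsol.reg_ρ.exists_isC1 hs hT0 hT
  obtain ⟨ut, ux, h2⟩ := hsol.reg_u.exists_isC1 hs hT0 hT
  obtain ⟨ht, hx, h3⟩ := hsol.reg_θ.exists_isC1 hs hT0 hT
  obtain ⟨qt, qx, h4⟩ := hsol.reg_q.exists_isC1 hs hT0 hT
  obtain ⟨St, Sx, h5⟩ := hsol.reg_S.exists_isC1 hs hT0 hT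
  have hI := Icc_subset_timeInterval hT
  refine ⟨rt, rx, ut, ux, ht, hx, qt, qx, St, Sx, h1, h2, h3, h4, h5, fun t ht x => ?_,
    fun t ht x => ?_⟩
  · obtain ⟨δ, hδ, hle⟩ := hsol.pos t (hI ht)
    rw [sub_add_cancel]
    exact hδ.trans_le (hle x).2
  · simp only [sub_add_cancel]
    exact hsol.eqs t (hI (Ioo_subset_Icc_self ht)) ht.1 x

end RelaxedNS

theorem proposition4p1 (c : RelaxedNS.Coeffs) (s : ℕ) (hs : 2 ≤ s)
    (ρ₀ u₀ θ₀ q₀ S₀ : ℝ → ℝ) (hdata : RelaxedNS.IsData s ρ₀ u₀ θ₀ q₀ S₀)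
    (T₀ : EReal) (hT₀ : 0 < T₀) (ρ u θ q S : ℝ → ℝ → ℝ)
    (hsol : RelaxedNS.IsSolution c s T₀ ρ₀ u₀ θ₀ q₀ S₀ ρ u θ q S)
    (M : ℝ) (hM : 0 < M)
    (hρ₀ : RelaxedNS.CompactlySupportedIn M (fun x => ρ₀ x - 1))
    (hu₀ : RelaxedNS.CompactlySupportedIn M u₀)
    (hθ₀ : RelaxedNS.CompactlySupportedIn M (fun x => θ₀ x - 1))
    (hq₀ : RelaxedNS.CompactlySupportedIn M q₀)
    (hS₀ : RelaxedNS.CompactlySupportedIn M S₀) :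
    ∃ σ : ℝ, 0 < σ ∧ ∀ t : ℝ, 0 ≤ t → (t : EReal) < T₀ → ∀ x : ℝ, M + σ * t ≤ |x| →
      ρ t x = 1 ∧ u t x = 0 ∧ θ t x = 1 ∧ q t x = 0 ∧ S t x = 0 := by
  obtain ⟨σ, hσ, hflux⟩ := c.exists_abs_linFlux_le
  refine ⟨σ, hσ, fun t ht0 htT x hx => ?_⟩
  obtain ⟨iρ, iu, iθ, iq, iS⟩ := hsol.init
  have h0 : ∀ x, M ≤ |x| → ρ 0 x - 1 = 0 ∧ u 0 x = 0 ∧ θ 0 x - 1 = 0 ∧ q 0 x = 0 ∧ S 0 x = 0 := by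
    intro x hx
    rw [iρ, iu, iθ, iq, iS]
    exact ⟨hρ₀.eq_zero hx, hu₀.eq_zero hx, hθ₀.eq_zero hx, hq₀.eq_zero hx, hS₀.eq_zero hx⟩
  have key : ρ t x - 1 = 0 ∧ u t x = 0 ∧ θ t x - 1 = 0 ∧ q t x = 0 ∧ S t x = 0 := by
    -- For `t > 0` the estimate is applied on `[0, t]`, with `t` itself as final time; the `C¹`
    -- statement needs an interval of positive length, so `t = 0` is read off the data.
    rcases ht0.eq_or_lt with rfl | htpos
    · exact h0 x (by simpa using hx)
    · obtain ⟨rt, rx, ut, ux, ht, hx', qt, qx, St, Sx, H⟩ :=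
        hsol.classicalSolution hs htpos htT
      exact H.eq_zero_of_initially_zero ht0 hσ.le hflux h0 hx
  obtain ⟨k1, k2, k3, k4, k5⟩ := key
  exact ⟨sub_eq_zero.1 k1, k2, sub_eq_zero.1 k3, k4, k5⟩
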